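/- Let $K$ be a field, let $S=K[Y_1,\dots,Y_r]$ be a polynomial ring, let $I\subset S$ be any ideal generated by monomials, set $R=S/I$, and write $y_k$ for the residue class of $Y_k$ in $R$. Let $P$ be a monomial prime ideal of $R$, that is, a prime ideal generated by residue classes of monomials; then $P$ is generated by the $y_k$ with $y_k\in P$. Grade $R$ by giving $y_k$ degree $1$ if $y_k\in P$ and degree $0$ if $y_k\notin P$. For $F\subseteq\{k : y_k\in P\}$ put $y_F=\prod_{k\in F}y_k$, and grade the localization $R_{y_F}$ by letting $(R_{y_F})_j$ consist of the fractions $f/y_F^l$ with $f\in R$ homogeneous and $\deg f-l\,|F|=j$. For $i\ge 0$ the local cohomology module $H^i_P(R)$ is the $i$-th cohomology of the Čech complex $C^\bullet$ with $$C^t=\bigoplus_{F\subseteq\{k : y_k\in P\},\ |F|=t}R_{y_F},$$ whose differential is given by the natural maps with the usual alternating signs, and it carries the induced $\mathbb Z$-grading $H^i_P(R)=\bigoplus_{j\in\mathbb Z}H^i_P(R)_j$. Then for every $i\ge 0$ the module $H^i_P(R)$ is tame: there is an integer $j_0$ such that either $H^i_P(R)_j=0$ for all $j\le j_0$, or $H^i_P(R)_j\ne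 0$ for all $j\le j_0$. -/

import Mathlib

open MvPolynomial

/-! ### The Čech complex of a finite family of elements of a commutative ring -/

/-- The localization `R_{x_F}`, where `x_F = ∏_{i ∈ F} x_i`. -/
abbrev CechLoc {R : Type*} [CommRing R] {r : ℕ} (x : Fin r → R) (F : Finset (Fin r)) : Type _ :=
  Localization.Away (∏ i ∈ F, x i)

/-- For `F ⊆ G`, the element `x_F` becomes a unit in `R_{x_G}`. -/
theorem cechLoc_isUnit {R : Type*} [CommRing R] {r : ℕ} (x : Fin r → R)
    {F G : Finset (Fin r)} (h : F ⊆ G) :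
    IsUnit (Algebra.ofId R (CechLoc x G) (∏ i ∈ F, x i)) :=
  IsLocalization.Away.isUnit_of_dvd (∏ i ∈ G, x i) (Finset.prod_dvd_prod_of_subset F G x h)

/-- The natural map `R_{x_F} → R_{x_G}` for `F ⊆ G`. -/
noncomputable def cechNat {R : Type*} [CommRing R] {r : ℕ} (x : Fin r → R)
    {F G : Finset (Fin r)} (h : F ⊆ G) : CechLoc x F →ₐ[R] CechLoc x G :=
  IsLocalization.Away.liftAlgHom (S := CechLoc x F) (∏ i ∈ F, x i) (cechLoc_isUnit x h)

/-- The module `C^t = ⨁_{F ⊆ A, |F| = t} R_{x_F}` of Čech cochains. -/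
abbrev CechCochain {R : Type*} [CommRing R] {r : ℕ} (x : Fin r → R) (A : Finset (Fin r))
    (t : ℕ) : Type _ :=
  (F : ↥(A.powersetCard t)) → CechLoc x F.1

theorem erase_mem_powersetCard {r : ℕ} {A G : Finset (Fin r)} {t : ℕ}
    (hG : G ∈ A.powersetCard (t + 1)) {s : Fin r} (hs : s ∈ G) :
    G.erase s ∈ A.powersetCard t := by
  rw [Finset.mem_powersetCard] at hG ⊢
  refine ⟨(Finset.erase_subset s G).trans hG.1, ?_⟩
  rw [Finset.card_erase_of_mem hs, hG.2, Nat.add_sub_cancel]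

/-- The Čech differential `C^t → C^{t+1}`: for `G = {j_1 < ⋯ < j_{t+1}}` its component
`R_{x_{G ∖ {j_s}}} → R_{x_G}` is `(-1)^{s-1}` times the natural map
(`s - 1` is the number of elements of `G` below `j_s`); all other components vanish. -/
noncomputable def cechD {R : Type*} [CommRing R] {r : ℕ} (x : Fin r → R) (A : Finset (Fin r))
    (t : ℕ) : CechCochain x A t →ₗ[R] CechCochain x A (t + 1) :=
  LinearMap.pi fun G =>
    ∑ s : ↥G.1, ((-1 : R) ^ (G.1.filter (fun k => k < s.1)).card) •
      ((cechNat x (Finset.erase_subset s.1 G.1)).toLinearMap ∘ₗ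
        LinearMap.proj (⟨G.1.erase s.1, erase_mem_powersetCard G.2 s.2⟩ : ↥(A.powersetCard t)))

theorem cechNat_comp {R : Type*} [CommRing R] {r : ℕ} (x : Fin r → R)
    {F G H : Finset (Fin r)} (h : F ⊆ G) (h' : G ⊆ H) (z : CechLoc x F) :
    cechNat x h' (cechNat x h z) = cechNat x (h.trans h') z := by
  have : ((cechNat x h').comp (cechNat x h)) = cechNat x (h.trans h') :=
    IsLocalization.algHom_ext (Submonoid.powers (∏ i ∈ F, x i)) (by ext)
  exact DFunLike.congr_fun this z

theorem cechD_apply {R : Type*} [CommRing R] {r : ℕ} (x : Fin r → R) (A : Finset (Fin r))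
    (t : ℕ) (c : CechCochain x A t) (G : ↥(A.powersetCard (t + 1))) :
    cechD x A t c G = ∑ s : ↥G.1, ((-1 : R) ^ (G.1.filter (fun k => k < s.1)).card) •
      cechNat x (Finset.erase_subset s.1 G.1)
        (c ⟨G.1.erase s.1, erase_mem_powersetCard G.2 s.2⟩) := by
  simp [cechD]

/-- Consecutive Čech differentials compose to zero. -/
theorem cechD_cechD {R : Type*} [CommRing R] {r : ℕ} (x : Fin r → R) (A : Finset (Fin r))
    (t : ℕ) (c : CechCochain x A t) : cechD x A (t + 1) (cechD x A t c) = 0 := by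
  funext G
  rw [cechD_apply]
  simp only [cechD_apply, map_sum, map_smul, Finset.smul_sum, cechNat_comp, smul_smul,
    ← pow_add, Pi.zero_apply]
  rw [Finset.sum_sigma']
  have key : ∀ {a b : Fin r}, a ∈ G.1 → b ∈ G.1 → a < b →
      (-1 : R) ^ ((G.1.filter (· < a)).card + ((G.1.erase a).filter (· < b)).card) +
      (-1 : R) ^ ((G.1.filter (· < b)).card + ((G.1.erase b).filter (· < a)).card) = 0 := by
    intro a b ha hb hab
    have h1 : ((G.1.erase a).filter (· < b)).card + 1 = (G.1.filter (· < b)).card := by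
      rw [Finset.filter_erase]
      exact Finset.card_erase_add_one (by simp [ha, hab])
    have h2 : ((G.1.erase b).filter (· < a)) = (G.1.filter (· < a)) := by
      rw [Finset.filter_erase]
      exact Finset.erase_eq_of_notMem (by simp [hab.le])
    rw [← h1, h2, ]
    ring
  have hcongr : ∀ {F F' : Finset (Fin r)} (e : F = F') (hF : F ∈ A.powersetCard t)
      (hF' : F' ∈ A.powersetCard t) (h : F ⊆ G.1) (h' : F' ⊆ G.1),
      cechNat x h (c ⟨F, hF⟩) = cechNat x h' (c ⟨F', hF'⟩) := by
    rintro F _ rfl _ _ _ _; rfl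
  refine Finset.sum_involution
    (fun p _ => ⟨⟨p.2.1, Finset.mem_of_mem_erase p.2.2⟩,
      ⟨p.1.1, Finset.mem_erase.2 ⟨(Finset.ne_of_mem_erase p.2.2).symm, p.1.2⟩⟩⟩) ?_ ?_ ?_ ?_
  · rintro ⟨⟨a, ha⟩, ⟨b, hb⟩⟩ -
    have hbG := Finset.mem_of_mem_erase hb
    have hne := Finset.ne_of_mem_erase hb
    dsimp only
    rw [hcongr (Finset.erase_right_comm (s := G.1) (a := a) (b := b)) _
      (erase_mem_powersetCard (erase_mem_powersetCard G.2 hbG)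
        (Finset.mem_erase.2 ⟨hne.symm, ha⟩)) _
      ((Finset.erase_subset _ _).trans (Finset.erase_subset _ _)), ← add_smul]
    rcases lt_or_gt_of_ne hne with h | h
    · rw [add_comm ((-1 : R) ^ _), key hbG ha h, zero_smul]
    · rw [key ha hbG h, zero_smul]
  · rintro ⟨⟨a, ha⟩, ⟨b, hb⟩⟩ - - h
    exact Finset.ne_of_mem_erase hb (congrArg (fun p => p.1.1) h)
  · intros; exact Finset.mem_univ _
  · intros; rfl

/-- The Čech cocycles `ker (C^t → C^{t+1})`. -/
noncomputable def cechCocycles {R : Type*} [CommRing R] {r : ℕ} (x : Fin r → R)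
    (A : Finset (Fin r)) (t : ℕ) : Submodule R (CechCochain x A t) :=
  LinearMap.ker (cechD x A t)

/-- The Čech coboundaries: the image of `C^{t-1} → C^t`, with `C^{-1} = 0`. -/
noncomputable def cechBoundaries {R : Type*} [CommRing R] {r : ℕ} (x : Fin r → R)
    (A : Finset (Fin r)) : (t : ℕ) → Submodule R (CechCochain x A t)
  | 0 => ⊥
  | t + 1 => LinearMap.range (cechD x A t)

/-- The cohomology module `H^t` of the Čech complex of the family `(x_i)_{i ∈ A}`. For a
Noetherian ring `R` this is the local cohomology module of `R` with support in the ideal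
generated by the `x_i`, `i ∈ A`. -/
abbrev CechCohomology {R : Type*} [CommRing R] {r : ℕ} (x : Fin r → R) (A : Finset (Fin r))
    (t : ℕ) : Type _ :=
  ↥(cechCocycles x A t) ⧸ (cechBoundaries x A t).submoduleOf (cechCocycles x A t)

/-! ### The grading of the Čech complex

Here `R` is a `K`-algebra with graded pieces `𝒜 d`, `d ∈ ℕ`, and the `x_i` with `i ∈ A` are
homogeneous of degree one, so that `x_F` has degree `|F|` for `F ⊆ A`. -/

/-- The piece `(R_{x_F})_j`, consisting of the fractions `f / x_F ^ l` with `f` homogeneous and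
`deg f - l * |F| = j` (these fractions are closed under addition, so that the span adds nothing).
-/
noncomputable def cechLocPiece {K R : Type*} [Field K] [CommRing R] [Algebra K R] {r : ℕ}
    (𝒜 : ℕ → Submodule K R) (x : Fin r → R) (F : Finset (Fin r)) (j : ℤ) :
    Submodule K (CechLoc x F) :=
  Submodule.span K {z | ∃ (d l : ℕ) (f : R), f ∈ 𝒜 d ∧ (d : ℤ) - (l : ℤ) * (F.card : ℤ) = j ∧
    z = Localization.mk f (⟨(∏ i ∈ F, x i) ^ l, l, rfl⟩ : Submonoid.powers (∏ i ∈ F, x i))}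

/-- The piece `(C^t)_j = ⨁_F (R_{x_F})_j` of the module of Čech cochains. -/
noncomputable def cechCochainPiece {K R : Type*} [Field K] [CommRing R] [Algebra K R] {r : ℕ}
    (𝒜 : ℕ → Submodule K R) (x : Fin r → R) (A : Finset (Fin r)) (t : ℕ) (j : ℤ) :
    Submodule K (CechCochain x A t) :=
  Submodule.pi Set.univ fun F => cechLocPiece 𝒜 x F.1 j

/-- The piece `(H^t)_j` of Čech cohomology: the classes of the cocycles of degree `j`. -/
noncomputable def cechCohomologyPiece {K R : Type*} [Field K] [CommRing R] [Algebra K R] {r : ℕ}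
    (𝒜 : ℕ → Submodule K R) (x : Fin r → R) (A : Finset (Fin r)) (t : ℕ) (j : ℤ) :
    Submodule K (CechCohomology x A t) :=
  Submodule.map
    ((((cechBoundaries x A t).submoduleOf (cechCocycles x A t)).mkQ).restrictScalars K)
    (Submodule.comap ((cechCocycles x A t).subtype.restrictScalars K)
      (cechCochainPiece 𝒜 x A t j))

/-- A family `(N_j)_{j ∈ ℤ}` of graded pieces is tame if there is `j₀` such that either `N_j = 0`
for all `j ≤ j₀`, or `N_j ≠ 0` for all `j ≤ j₀`. -/
def IsTame {K N : Type*} [Field K] [AddCommGroup N] [Module K N] (𝒩 : ℤ → Submodule K N) : Prop :=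
  ∃ j₀ : ℤ, (∀ j ≤ j₀, 𝒩 j = ⊥) ∨ (∀ j ≤ j₀, 𝒩 j ≠ ⊥)

/-! ### Monomial ideals and monomial prime ideals -/

/-- An ideal of `K[Y_1, …, Y_r]` generated by monomials. -/
def IsMonomialIdeal {K : Type*} [Field K] {r : ℕ} (I : Ideal (MvPolynomial (Fin r) K)) : Prop :=
  ∃ T : Set (Fin r →₀ ℕ), I = Ideal.span ((fun a => monomial a (1 : K)) '' T)

/-- The residue classes `y_i` of the variables in `K[Y_1, …, Y_r] / I`. -/
noncomputable def residueVar {K : Type*} [Field K] {r : ℕ} (I : Ideal (MvPolynomial (Fin r) K))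
    (i : Fin r) : MvPolynomial (Fin r) K ⧸ I :=
  Ideal.Quotient.mk I (X i)

/-- A monomial prime ideal of `K[Y_1, …, Y_r] / I`: a prime ideal generated by residue classes of
monomials. -/
def IsMonomialPrime {K : Type*} [Field K] {r : ℕ} {I : Ideal (MvPolynomial (Fin r) K)}
    (P : Ideal (MvPolynomial (Fin r) K ⧸ I)) : Prop :=
  P.IsPrime ∧ ∃ T : Set (Fin r →₀ ℕ),
    P = Ideal.span ((fun a => Ideal.Quotient.mk I (monomial a (1 : K))) '' T)

open Classical in
/-- The set of indices `i` with `y_i ∈ P`. -/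
noncomputable def varsIn {K : Type*} [Field K] {r : ℕ} {I : Ideal (MvPolynomial (Fin r) K)}
    (P : Ideal (MvPolynomial (Fin r) K ⧸ I)) : Finset (Fin r) :=
  Finset.univ.filter fun i => residueVar I i ∈ P

/-- A monomial prime ideal is generated by the residue classes of the variables it contains. -/
theorem IsMonomialPrime.eq_span_residueVar {K : Type*} [Field K] {r : ℕ}
    {I : Ideal (MvPolynomial (Fin r) K)} {P : Ideal (MvPolynomial (Fin r) K ⧸ I)}
    (hP : IsMonomialPrime P) :
    P = Ideal.span (residueVar I '' (varsIn P : Set (Fin r))) := by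
  obtain ⟨hprime, T, hT⟩ := hP
  apply le_antisymm
  · conv_lhs => rw [hT]
    rw [Ideal.span_le]
    rintro _ ⟨a, ha, rfl⟩
    have hmem : Ideal.Quotient.mk I (monomial a (1 : K)) ∈ P := by
      rw [hT]; exact Ideal.subset_span ⟨a, ha, rfl⟩
    have hprod : Ideal.Quotient.mk I (monomial a (1 : K)) = ∏ i, residueVar I i ^ a i := by
      rw [monomial_eq, C_1, one_mul, Finsupp.prod_fintype _ _ (fun i => pow_zero _), map_prod]
      simp [residueVar]
    rw [hprod] at hmem
    obtain ⟨i, -, hi⟩ := hprime.prod_mem_iff.1 hmem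
    have ha0 : a i ≠ 0 := by
      intro h0
      rw [h0, pow_zero] at hi
      exact hprime.ne_top ((Ideal.eq_top_iff_one P).2 hi)
    have hiP : residueVar I i ∈ P := hprime.mem_of_pow_mem _ hi
    have : residueVar I i ∈ Ideal.span (residueVar I '' (varsIn P : Set (Fin r))) :=
      Ideal.subset_span ⟨i, by simpa [varsIn] using hiP, rfl⟩
    change Ideal.Quotient.mk I (monomial a (1 : K)) ∈ _
    rw [hprod]
    exact Ideal.mem_of_dvd _ ((dvd_pow_self _ ha0).trans
      (Finset.dvd_prod_of_mem _ (Finset.mem_univ i))) this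
  · rw [Ideal.span_le]
    rintro _ ⟨i, hi, rfl⟩
    simpa [varsIn] using hi

open Classical in
/-- The weights defining the grading: the variables `Y_i` with `y_i ∈ P` have degree `1`, the
other variables have degree `0`. -/
noncomputable def primeWeight {K : Type*} [Field K] {r : ℕ} {I : Ideal (MvPolynomial (Fin r) K)}
    (P : Ideal (MvPolynomial (Fin r) K ⧸ I)) (i : Fin r) : ℕ :=
  if i ∈ varsIn P then 1 else 0

/-- The graded pieces `R_d` of `R = K[Y_1, …, Y_r] / I` with respect to these weights. -/
noncomputable def quotientPiece {K : Type*} [Field K] {r : ℕ} {I : Ideal (MvPolynomial (Fin r) K)}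
    (P : Ideal (MvPolynomial (Fin r) K ⧸ I)) (d : ℕ) : Submodule K (MvPolynomial (Fin r) K ⧸ I) :=
  (weightedHomogeneousSubmodule K (primeWeight P) d).map (Ideal.Quotient.mkₐ K I).toLinearMap

/-- The local cohomology module `H^i_P(R)` of `R = K[Y_1, …, Y_r] / I` at a monomial prime ideal
`P`, realized as the cohomology of the Čech complex on the generators `y_k ∈ P`. -/
abbrev MonomialLocalCohomology {K : Type*} [Field K] {r : ℕ} {I : Ideal (MvPolynomial (Fin r) K)}
    (P : Ideal (MvPolynomial (Fin r) K ⧸ I)) (i : ℕ) : Type _ :=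
  CechCohomology (residueVar I) (varsIn P) i

/-- The graded piece `H^i_P(R)_j`. -/
noncomputable def monomialLocalCohomologyPiece {K : Type*} [Field K] {r : ℕ}
    {I : Ideal (MvPolynomial (Fin r) K)} (P : Ideal (MvPolynomial (Fin r) K ⧸ I)) (i : ℕ) (j : ℤ) :
    Submodule K (MonomialLocalCohomology P i) :=
  cechCohomologyPiece (quotientPiece P) (residueVar I) (varsIn P) i j

/-! Since `I` is generated by monomials, the torus acts on `R`, and the Čech complex is graded by
`ℤ^r`, more finely than by total degree over `A = varsIn P`. The action is encoded as a coaction `ρ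
: R → R[ℤ^r]` sending `x_i` to `x_i` in degree `e_i`; it extends to every `R_{x_F}`, and its
coefficients are projections onto multidegrees that commute with the Čech differential.

The key claim is that, for `j < 0`, `(H^t)_j` is spanned by products of some `x_k`, `k ∈ A`, with
classes in `(H^t)_{j-1}`. A cocycle of degree `j` splits into multihomogeneous cocycles. If such a
component has multidegree `a` with `∑_{i ∈ A} a_i = j < 0`, then `a_k < 0` for some `k ∈ A`. It
vanishes at every `F` not containing `k` (`cechFinePiece_eq_bot`), and at the other `F` it is
divisible by the unit `x_k` (`exists_mul_eq_of_mem_cechFinePiece`). The quotient is again a cocycle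
(`cechD_eq_zero_of_smul`), of degree `j - 1`. Hence nonvanishing in one negative degree propagates
to all lower degrees (`cechCohomologyPiece_sub_one_ne_bot`), which gives tameness. -/

/-! ### The fine grading of the localizations -/

section FineGrading

variable {K R : Type*} [Field K] [CommRing R] [Algebra K R] {r : ℕ}

/-- The fraction `x^u / x_F^l`. -/
noncomputable def cechMonomial (x : Fin r → R) (F : Finset (Fin r)) (u : Fin r → ℕ) (l : ℕ) :
    CechLoc x F :=
  Localization.mk (∏ i, x i ^ u i)
    (⟨(∏ i ∈ F, x i) ^ l, l, rfl⟩ : Submonoid.powers (∏ i ∈ F, x i))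

/-- The multidegree of the fraction `x^u / x_F^l`. -/
def cechMultidegree (F : Finset (Fin r)) (u : Fin r → ℕ) (l : ℕ) : Fin r → ℤ :=
  fun i => (u i : ℤ) - if i ∈ F then (l : ℤ) else 0

/-- The part of `R_{x_F}` of multidegree `a`. -/
noncomputable def cechFinePiece (K : Type*) {R : Type*} [Field K] [CommRing R] [Algebra K R]
    {r : ℕ} (x : Fin r → R) (F : Finset (Fin r)) (a : Fin r → ℤ) : Submodule K (CechLoc x F) :=
  Submodule.span K {z | ∃ u l, cechMultidegree F u l = a ∧ z = cechMonomial x F u l}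

theorem mk_mul_algebraMap_pow (x : Fin r → R) (F : Finset (Fin r)) (f : R) (l : ℕ) :
    (Localization.mk f (⟨(∏ i ∈ F, x i) ^ l, l, rfl⟩ : Submonoid.powers (∏ i ∈ F, x i)) :
      CechLoc x F) * algebraMap R (CechLoc x F) ((∏ i ∈ F, x i) ^ l) =
      algebraMap R (CechLoc x F) f := by
  rw [Localization.mk_eq_mk'_apply]
  exact IsLocalization.mk'_spec (CechLoc x F) f
    (⟨(∏ i ∈ F, x i) ^ l, l, rfl⟩ : Submonoid.powers (∏ i ∈ F, x i))

theorem eq_mk_of_mul_algebraMap_pow (x : Fin r → R) (F : Finset (Fin r)) {z : CechLoc x F} {f : R}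
    {l : ℕ} (h : z * algebraMap R (CechLoc x F) ((∏ i ∈ F, x i) ^ l) =
      algebraMap R (CechLoc x F) f) :
    z = Localization.mk f
      (⟨(∏ i ∈ F, x i) ^ l, l, rfl⟩ : Submonoid.powers (∏ i ∈ F, x i)) := by
  rw [Localization.mk_eq_mk'_apply]
  exact IsLocalization.eq_mk'_iff_mul_eq.2 h

theorem isUnit_algebraMap_of_mem (x : Fin r → R) {F : Finset (Fin r)} {k : Fin r} (hk : k ∈ F) :
    IsUnit (algebraMap R (CechLoc x F) (x k)) :=
  IsLocalization.Away.isUnit_of_dvd (∏ i ∈ F, x i) (Finset.dvd_prod_of_mem x hk)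

/-- For `k ∉ F` the denominator `x_F ^ l` contributes nothing to the `k`-th exponent, so no fraction
has negative `k`-th degree. -/
theorem cechFinePiece_eq_bot {x : Fin r → R} {F : Finset (Fin r)} {a : Fin r → ℤ} {k : Fin r}
    (hk : k ∉ F) (ha : a k < 0) : cechFinePiece K x F a = ⊥ := by
  rw [cechFinePiece, Submodule.span_eq_bot]
  rintro _ ⟨u, l, rfl, -⟩
  simp only [cechMultidegree, hk, if_false] at ha
  omega

/-- The inverse of `x_i` in degree `e_i` is `x_i⁻¹` in degree `-e_i`; this is why exponents are
taken in `ℤ`. It lets the coaction extend to the localization. -/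
theorem isUnit_coaction {x : Fin r → R} {ρ : R →ₐ[K] AddMonoidAlgebra R (Fin r → ℤ)}
    (hρ : ∀ i, ρ (x i) = AddMonoidAlgebra.single (Pi.single i 1) (x i)) (F : Finset (Fin r)) :
    IsUnit (((AddMonoidAlgebra.mapAlgHom (Fin r → ℤ)
      (IsScalarTower.toAlgHom K R (CechLoc x F))).comp ρ) (∏ i ∈ F, x i)) := by
  rw [map_prod, IsUnit.prod_iff]
  intro i hi
  obtain ⟨b, hb⟩ := (isUnit_algebraMap_of_mem x hi).exists_right_inv
  refine IsUnit.of_mul_eq_one (AddMonoidAlgebra.single (-Pi.single i 1) b) ?_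
  simp [hρ, AddMonoidAlgebra.mapAlgHom, AddMonoidAlgebra.single_mul_single, hb,
    AddMonoidAlgebra.one_def]

/-- The coaction of the torus on `R_{x_F}`, given its coaction on `R`. -/
noncomputable def cechCoaction {x : Fin r → R} {ρ : R →ₐ[K] AddMonoidAlgebra R (Fin r → ℤ)}
    (hρ : ∀ i, ρ (x i) = AddMonoidAlgebra.single (Pi.single i 1) (x i)) (F : Finset (Fin r)) :
    CechLoc x F →ₐ[K] AddMonoidAlgebra (CechLoc x F) (Fin r → ℤ) :=
  IsLocalization.Away.liftAlgHom (∏ i ∈ F, x i) (isUnit_coaction hρ F)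

theorem cechCoaction_algebraMap {x : Fin r → R} {ρ : R →ₐ[K] AddMonoidAlgebra R (Fin r → ℤ)}
    (hρ : ∀ i, ρ (x i) = AddMonoidAlgebra.single (Pi.single i 1) (x i)) (F : Finset (Fin r))
    (f : R) : cechCoaction hρ F (algebraMap R (CechLoc x F) f) =
      AddMonoidAlgebra.mapRingHom (Fin r → ℤ) (algebraMap R (CechLoc x F)) (ρ f) :=
  IsLocalization.Away.lift_eq _ (isUnit_coaction hρ F) f

theorem coaction_prod_pow {x : Fin r → R} {ρ : R →ₐ[K] AddMonoidAlgebra R (Fin r → ℤ)}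
    (hρ : ∀ i, ρ (x i) = AddMonoidAlgebra.single (Pi.single i 1) (x i)) (u : Fin r → ℕ) :
    ρ (∏ i, x i ^ u i) = AddMonoidAlgebra.single (fun i => (u i : ℤ)) (∏ i, x i ^ u i) := by
  simp only [map_prod, map_pow, hρ, AddMonoidAlgebra.single_pow, AddMonoidAlgebra.prod_single]
  congr 1
  ext i
  simp [Finset.sum_apply, Pi.single_apply]

theorem coaction_pow_prod {x : Fin r → R} {ρ : R →ₐ[K] AddMonoidAlgebra R (Fin r → ℤ)}
    (hρ : ∀ i, ρ (x i) = AddMonoidAlgebra.single (Pi.single i 1) (x i)) (F : Finset (Fin r))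
    (l : ℕ) : ρ ((∏ i ∈ F, x i) ^ l) =
      AddMonoidAlgebra.single (fun i => if i ∈ F then (l : ℤ) else 0) ((∏ i ∈ F, x i) ^ l) := by
  simp only [map_prod, map_pow, hρ, AddMonoidAlgebra.single_pow, AddMonoidAlgebra.prod_single]
  congr 1
  ext i
  simp [Finset.sum_apply, Pi.single_apply]

theorem cechCoaction_cechMonomial {x : Fin r → R} {ρ : R →ₐ[K] AddMonoidAlgebra R (Fin r → ℤ)}
    (hρ : ∀ i, ρ (x i) = AddMonoidAlgebra.single (Pi.single i 1) (x i)) (F : Finset (Fin r))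
    (u : Fin r → ℕ) (l : ℕ) :
    cechCoaction hρ F (cechMonomial x F u l) =
      AddMonoidAlgebra.single (cechMultidegree F u l) (cechMonomial x F u l) := by
  -- Clearing the denominator reduces the claim to monomials of `R`, where the coaction is known.
  have hunit : IsUnit (cechCoaction hρ F (algebraMap R (CechLoc x F) ((∏ i ∈ F, x i) ^ l))) := by
    rw [map_pow]
    exact ((IsLocalization.Away.algebraMap_isUnit (S := CechLoc x F) (∏ i ∈ F, x i)).pow l).map _
  refine hunit.mul_left_injective ?_
  dsimp only
  rw [← map_mul, cechCoaction_algebraMap hρ F ((∏ i ∈ F, x i) ^ l), coaction_pow_prod hρ,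
    AddMonoidAlgebra.mapRingHom_single, AddMonoidAlgebra.single_mul_single, cechMonomial,
    mk_mul_algebraMap_pow, cechCoaction_algebraMap, coaction_prod_pow hρ,
    AddMonoidAlgebra.mapRingHom_single]
  congr 1
  ext i
  simp [cechMultidegree]

/-- Two ring homomorphisms out of a localization agree once they agree on `R`, and there both are
induced by `ρ`. -/
theorem map_cechCoaction {x : Fin r → R} {ρ : R →ₐ[K] AddMonoidAlgebra R (Fin r → ℤ)}
    (hρ : ∀ i, ρ (x i) = AddMonoidAlgebra.single (Pi.single i 1) (x i)) {F G : Finset (Fin r)}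
    (h : F ⊆ G) (z : CechLoc x F) :
    cechCoaction hρ G (cechNat x h z) =
      AddMonoidAlgebra.mapRingHom (Fin r → ℤ) (cechNat x h).toRingHom (cechCoaction hρ F z) := by
  have : (cechCoaction hρ G).toRingHom.comp (cechNat x h).toRingHom =
      (AddMonoidAlgebra.mapRingHom (Fin r → ℤ) (cechNat x h).toRingHom).comp
        (cechCoaction hρ F).toRingHom := by
    refine IsLocalization.ringHom_ext (Submonoid.powers (∏ i ∈ F, x i)) ?_
    ext f : 1
    change cechCoaction hρ G (cechNat x h (algebraMap R _ f)) =
      AddMonoidAlgebra.mapRingHom (Fin r → ℤ) (cechNat x h).toRingHom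
        (cechCoaction hρ F (algebraMap R _ f))
    rw [AlgHom.commutes, cechCoaction_algebraMap, cechCoaction_algebraMap, ← RingHom.comp_apply,
      ← AddMonoidAlgebra.mapRingHom_comp]
    congr 2
    ext f
    exact ((cechNat x h).commutes f).symm
  exact DFunLike.congr_fun this z

/-- The component of multidegree `a` of an element of `R_{x_F}`. -/
noncomputable def cechComponent {x : Fin r → R} {ρ : R →ₐ[K] AddMonoidAlgebra R (Fin r → ℤ)}
    (hρ : ∀ i, ρ (x i) = AddMonoidAlgebra.single (Pi.single i 1) (x i)) (F : Finset (Fin r))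
    (a : Fin r → ℤ) : CechLoc x F →ₗ[K] CechLoc x F where
  toFun z := (cechCoaction hρ F z).coeff a
  map_add' y z := by simp
  map_smul' c z := by simp

theorem cechComponent_cechNat {x : Fin r → R} {ρ : R →ₐ[K] AddMonoidAlgebra R (Fin r → ℤ)}
    (hρ : ∀ i, ρ (x i) = AddMonoidAlgebra.single (Pi.single i 1) (x i)) {F G : Finset (Fin r)}
    (h : F ⊆ G) (a : Fin r → ℤ) (z : CechLoc x F) :
    cechComponent hρ G a (cechNat x h z) = cechNat x h (cechComponent hρ F a z) := by
  simp [cechComponent, map_cechCoaction]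

open Classical in
theorem cechComponent_cechMonomial {x : Fin r → R} {ρ : R →ₐ[K] AddMonoidAlgebra R (Fin r → ℤ)}
    (hρ : ∀ i, ρ (x i) = AddMonoidAlgebra.single (Pi.single i 1) (x i)) (F : Finset (Fin r))
    (a : Fin r → ℤ) (u : Fin r → ℕ) (l : ℕ) :
    cechComponent hρ F a (cechMonomial x F u l) =
      if cechMultidegree F u l = a then cechMonomial x F u l else 0 := by
  change (cechCoaction hρ F (cechMonomial x F u l)).coeff a = _
  rw [cechCoaction_cechMonomial, AddMonoidAlgebra.coeff_single, Finsupp.single_apply]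

/-- Dividing by the power `x_F^l`, as a `K`-linear map `R → R_{x_F}`. -/
noncomputable def cechMk (K : Type*) {R : Type*} [Field K] [CommRing R] [Algebra K R] {r : ℕ}
    (x : Fin r → R) (F : Finset (Fin r)) (l : ℕ) : R →ₗ[K] CechLoc x F where
  toFun f := Localization.mk f (⟨(∏ i ∈ F, x i) ^ l, l, rfl⟩ : Submonoid.powers (∏ i ∈ F, x i))
  map_add' f g := (Localization.add_mk_self f _ g).symm
  map_smul' c f := (Localization.smul_mk c f _).symm

/-! ### Decomposition into multihomogeneous components -/

theorem mk_mem_span_cechMonomial (x : Fin r → R) (F : Finset (Fin r)) {U : Set (Fin r → ℕ)} {f : R}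
    (hf : f ∈ Submodule.span K ((fun u : Fin r → ℕ => ∏ i, x i ^ u i) '' U)) (l : ℕ) :
    Localization.mk f (⟨(∏ i ∈ F, x i) ^ l, l, rfl⟩ : Submonoid.powers (∏ i ∈ F, x i)) ∈
      Submodule.span K ((fun u => cechMonomial x F u l) '' U) := by
  have := Submodule.mem_map_of_mem (f := cechMk K x F l) hf
  rw [Submodule.map_span, Set.image_image] at this
  exact this

theorem span_cechMonomial_eq_top {x : Fin r → R}
    (hx : Submodule.span K (Set.range fun u : Fin r → ℕ => ∏ i, x i ^ u i) = ⊤)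
    (F : Finset (Fin r)) :
    Submodule.span K {z | ∃ u l, z = cechMonomial x F u l} = ⊤ := by
  refine eq_top_iff.2 fun z _ => ?_
  induction z using Localization.induction_on with
  | H p =>
    obtain ⟨f, ⟨_, l, rfl⟩⟩ := p
    have hf : f ∈ Submodule.span K ((fun u : Fin r → ℕ => ∏ i, x i ^ u i) '' Set.univ) := by
      rw [Set.image_univ, hx]; trivial
    refine Submodule.span_mono ?_ (mk_mem_span_cechMonomial x F hf l)
    rintro _ ⟨u, -, rfl⟩
    exact ⟨u, l, rfl⟩

theorem cechComponent_mem {x : Fin r → R} {ρ : R →ₐ[K] AddMonoidAlgebra R (Fin r → ℤ)}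
    (hρ : ∀ i, ρ (x i) = AddMonoidAlgebra.single (Pi.single i 1) (x i))
    (hx : Submodule.span K (Set.range fun u : Fin r → ℕ => ∏ i, x i ^ u i) = ⊤)
    (F : Finset (Fin r)) (a : Fin r → ℤ) (z : CechLoc x F) :
    cechComponent hρ F a z ∈ cechFinePiece K x F a := by
  have hz : z ∈ Submodule.span K {z | ∃ u l, z = cechMonomial x F u l} := by
    rw [span_cechMonomial_eq_top hx]; trivial
  induction hz using Submodule.span_induction with
  | mem z hz =>
    obtain ⟨u, l, rfl⟩ := hz
    rw [cechComponent_cechMonomial]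
    split_ifs with h
    · exact Submodule.subset_span ⟨u, l, h, rfl⟩
    · exact zero_mem _
  | zero => rw [map_zero]; exact zero_mem _
  | add y z _ _ hy hz => rw [map_add]; exact add_mem hy hz
  | smul c z _ hz => rw [map_smul]; exact Submodule.smul_mem _ _ hz

/-- Allowing every larger `T'` makes it possible to use one finite set for several elements, and for
all `F` at once in a cochain. -/
theorem exists_sum_cechComponent {x : Fin r → R} {ρ : R →ₐ[K] AddMonoidAlgebra R (Fin r → ℤ)}
    (hρ : ∀ i, ρ (x i) = AddMonoidAlgebra.single (Pi.single i 1) (x i))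
    (hx : Submodule.span K (Set.range fun u : Fin r → ℕ => ∏ i, x i ^ u i) = ⊤)
    (F : Finset (Fin r)) (z : CechLoc x F) :
    ∃ T : Finset (Fin r → ℤ), ∀ T', T ⊆ T' → ∑ a ∈ T', cechComponent hρ F a z = z := by
  classical
  have hz : z ∈ Submodule.span K {z | ∃ u l, z = cechMonomial x F u l} := by
    rw [span_cechMonomial_eq_top hx]; trivial
  induction hz using Submodule.span_induction with
  | mem z hz =>
    obtain ⟨u, l, rfl⟩ := hz
    refine ⟨{cechMultidegree F u l}, fun T' hT' => ?_⟩
    simp only [cechComponent_cechMonomial]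
    rw [Finset.sum_ite_eq, if_pos (hT' (Finset.mem_singleton_self _))]
  | zero => exact ⟨∅, fun T' _ => by simp⟩
  | add y z _ _ hy hz =>
    obtain ⟨S, hS⟩ := hy
    obtain ⟨T, hT⟩ := hz
    refine ⟨S ∪ T, fun T' h => ?_⟩
    simp only [map_add, Finset.sum_add_distrib]
    rw [hS T' (Finset.union_subset_left h), hT T' (Finset.union_subset_right h)]
  | smul c z _ hz =>
    obtain ⟨T, hT⟩ := hz
    refine ⟨T, fun T' h => ?_⟩
    simp only [map_smul, ← Finset.smul_sum]
    rw [hT T' h]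

theorem exists_mul_eq_of_mem_cechFinePiece {x : Fin r → R} {F : Finset (Fin r)} {k : Fin r}
    (hk : k ∈ F) {a : Fin r → ℤ} {z : CechLoc x F} (hz : z ∈ cechFinePiece K x F a) :
    ∃ w ∈ cechFinePiece K x F (a - Pi.single k 1), x k • w = z := by
  induction hz using Submodule.span_induction with
  | mem z hz =>
    obtain ⟨u, l, rfl, rfl⟩ := hz
    -- Expand the fraction by `x_F` and split off `x_k`: `x^u / x_F^l = x_k * (x^u * x_{F ∖ {k}} /
    -- x_F^(l+1))`.
    refine ⟨cechMonomial x F (fun i => u i + if i ∈ F.erase k then 1 else 0) (l + 1),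
      Submodule.subset_span ⟨_, _, ?_, rfl⟩, ?_⟩
    · ext i
      by_cases hik : i = k
      · subst hik; simp [cechMultidegree, hk]; ring
      · by_cases hi : i ∈ F <;> simp [cechMultidegree, hik, hi]
    · refine eq_mk_of_mul_algebraMap_pow x F ?_
      have hmul : cechMonomial x F (fun i => u i + if i ∈ F.erase k then 1 else 0) (l + 1) *
          algebraMap R (CechLoc x F) ((∏ i ∈ F, x i) ^ (l + 1)) = algebraMap R (CechLoc x F)
            (∏ i, x i ^ (u i + if i ∈ F.erase k then 1 else 0)) :=
        mk_mul_algebraMap_pow x F _ (l + 1)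
      have hprod : x k * ∏ i, x i ^ (u i + if i ∈ F.erase k then 1 else 0) =
          (∏ i ∈ F, x i) * ∏ i, x i ^ u i := by
        rw [← Finset.mul_prod_erase F x hk]
        simp only [pow_add, Finset.prod_mul_distrib, pow_ite, pow_one, pow_zero,
          Finset.prod_ite_mem, Finset.univ_inter]
        ring
      -- The candidate has denominator `x_F ^ (l + 1)`, so one more unit factor `x_F` is multiplied
      -- in before comparing numerators.
      refine (IsLocalization.Away.algebraMap_isUnit (S := CechLoc x F)
        (∏ i ∈ F, x i)).mul_right_injective ?_
      dsimp only
      rw [← map_mul, ← hprod, map_mul, ← hmul, pow_succ, map_mul, Algebra.smul_def]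
      ring
  | zero => exact ⟨0, zero_mem _, smul_zero _⟩
  | add y z _ _ hy hz =>
    obtain ⟨v, hv, rfl⟩ := hy
    obtain ⟨w, hw, rfl⟩ := hz
    exact ⟨v + w, add_mem hv hw, smul_add _ _ _⟩
  | smul c z _ hz =>
    obtain ⟨w, hw, rfl⟩ := hz
    exact ⟨c • w, Submodule.smul_mem _ _ hw, smul_comm _ _ _⟩

end FineGrading

/-! ### Lowering the degree of cohomology classes -/

section Lowering

variable {K R : Type*} [Field K] [CommRing R] [Algebra K R] {r : ℕ}

theorem cechFinePiece_le_cechLocPiece {x : Fin r → R} {A : Finset (Fin r)}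
    {𝒜 : ℕ → Submodule K R}
    (h𝒜 : ∀ d, 𝒜 d = Submodule.span K ((fun u : Fin r → ℕ => ∏ i, x i ^ u i) ''
      {u | ∑ i ∈ A, u i = d})) {F : Finset (Fin r)} (hF : F ⊆ A) (a : Fin r → ℤ) :
    cechFinePiece K x F a ≤ cechLocPiece 𝒜 x F (∑ i ∈ A, a i) := by
  rw [cechFinePiece, Submodule.span_le]
  rintro _ ⟨u, l, rfl, rfl⟩
  refine Submodule.subset_span ⟨∑ i ∈ A, u i, l, ∏ i, x i ^ u i, ?_, ?_, rfl⟩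
  · rw [h𝒜]
    exact Submodule.subset_span ⟨u, rfl, rfl⟩
  · simp [cechMultidegree, Finset.sum_ite_mem, Finset.inter_eq_right.2 hF, mul_comm]

/-- As `F ⊆ A`, each monomial fraction in degree `j` has a multidegree whose sum over `A` is `j`, so
it has no component elsewhere. -/
theorem cechComponent_eq_zero_of_mem_cechLocPiece {x : Fin r → R}
    {ρ : R →ₐ[K] AddMonoidAlgebra R (Fin r → ℤ)}
    (hρ : ∀ i, ρ (x i) = AddMonoidAlgebra.single (Pi.single i 1) (x i)) {A : Finset (Fin r)}
    {𝒜 : ℕ → Submodule K R}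
    (h𝒜 : ∀ d, 𝒜 d = Submodule.span K ((fun u : Fin r → ℕ => ∏ i, x i ^ u i) ''
      {u | ∑ i ∈ A, u i = d})) {F : Finset (Fin r)} (hF : F ⊆ A) {a : Fin r → ℤ} {j : ℤ}
    (ha : ∑ i ∈ A, a i ≠ j) {z : CechLoc x F} (hz : z ∈ cechLocPiece 𝒜 x F j) :
    cechComponent hρ F a z = 0 := by
  change z ∈ LinearMap.ker (cechComponent hρ F a)
  revert z
  change cechLocPiece 𝒜 x F j ≤ _
  rw [cechLocPiece, Submodule.span_le]
  rintro _ ⟨d, l, f, hf, hj, rfl⟩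
  rw [h𝒜] at hf
  refine Submodule.span_le.2 ?_ (mk_mem_span_cechMonomial x F hf l)
  rintro _ ⟨u, hu, rfl⟩
  rw [SetLike.mem_coe, LinearMap.mem_ker, cechComponent_cechMonomial, if_neg]
  rintro rfl
  apply ha
  rw [← hj, ← (show ∑ i ∈ A, u i = d from hu)]
  simp [cechMultidegree, Finset.sum_ite_mem, Finset.inter_eq_right.2 hF, mul_comm]

/-- The component of multidegree `a` of a Čech cochain. -/
noncomputable def cechCochainComponent {x : Fin r → R} {ρ : R →ₐ[K] AddMonoidAlgebra R (Fin r → ℤ)}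
    (hρ : ∀ i, ρ (x i) = AddMonoidAlgebra.single (Pi.single i 1) (x i)) (A : Finset (Fin r))
    (t : ℕ) (a : Fin r → ℤ) (c : CechCochain x A t) : CechCochain x A t :=
  fun F => cechComponent hρ F.1 a (c F)

theorem cechD_cechCochainComponent {x : Fin r → R} {ρ : R →ₐ[K] AddMonoidAlgebra R (Fin r → ℤ)}
    (hρ : ∀ i, ρ (x i) = AddMonoidAlgebra.single (Pi.single i 1) (x i)) (A : Finset (Fin r))
    (t : ℕ) (a : Fin r → ℤ) (c : CechCochain x A t) :
    cechD x A t (cechCochainComponent hρ A t a c) =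
      cechCochainComponent hρ A (t + 1) a (cechD x A t c) := by
  -- The projections are only `K`-linear, while the signs are scalars in `R`.
  have hsign : ∀ (n : ℕ) (G : Finset (Fin r)) (z : CechLoc x G),
      cechComponent hρ G a ((-1 : R) ^ n • z) = (-1 : R) ^ n • cechComponent hρ G a z := by
    intro n G z
    rcases neg_one_pow_eq_or R n with h | h <;> simp [h]
  funext G
  simp only [cechCochainComponent, cechD_apply, map_sum, hsign, cechComponent_cechNat]

theorem exists_sum_cechCochainComponent {x : Fin r → R}
    {ρ : R →ₐ[K] AddMonoidAlgebra R (Fin r → ℤ)}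
    (hρ : ∀ i, ρ (x i) = AddMonoidAlgebra.single (Pi.single i 1) (x i))
    (hx : Submodule.span K (Set.range fun u : Fin r → ℕ => ∏ i, x i ^ u i) = ⊤)
    (A : Finset (Fin r)) (t : ℕ) (c : CechCochain x A t) :
    ∃ T : Finset (Fin r → ℤ), ∑ a ∈ T, cechCochainComponent hρ A t a c = c := by
  classical
  choose T hT using fun F : ↥(A.powersetCard t) => exists_sum_cechComponent hρ hx F.1 (c F)
  refine ⟨Finset.univ.biUnion T, ?_⟩
  funext F
  rw [Finset.sum_apply]
  exact hT F _ (Finset.subset_biUnion_of_mem T (Finset.mem_univ F))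

theorem cechCohomologyPiece_eq_bot_iff {𝒜 : ℕ → Submodule K R} {x : Fin r → R}
    {A : Finset (Fin r)} {t : ℕ} {j : ℤ} :
    cechCohomologyPiece 𝒜 x A t j = ⊥ ↔ ∀ c ∈ cechCochainPiece 𝒜 x A t j,
      cechD x A t c = 0 → c ∈ cechBoundaries x A t := by
  rw [cechCohomologyPiece, eq_bot_iff]
  constructor
  · intro h c hc hd
    have hmem := h ⟨(⟨c, hd⟩ : ↥(cechCocycles x A t)), hc, rfl⟩
    exact (Submodule.Quotient.mk_eq_zero
      ((cechBoundaries x A t).submoduleOf (cechCocycles x A t))).1 hmem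
  · rintro h _ ⟨⟨c, hd⟩, hc, rfl⟩
    exact (Submodule.Quotient.mk_eq_zero _).2 (h c hc hd)

/-- If `x_k c` is a cocycle and `c` vanishes on all `F` not containing `k`, then `c` is a cocycle. -/
theorem cechD_eq_zero_of_smul {x : Fin r → R} {A : Finset (Fin r)} {t : ℕ} {k : Fin r}
    {c : CechCochain x A t} (hc : ∀ F, k ∉ F.1 → c F = 0) (hd : cechD x A t (x k • c) = 0) :
    cechD x A t c = 0 := by
  funext G
  -- For `k ∈ G` the unit `x_k` cancels in `R_{x_G}`; for `k ∉ G` no face `G ∖ {s}` contains `k`, so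
  -- every summand is zero.
  by_cases hk : k ∈ G.1
  · have h := congrFun hd G
    rw [map_smul, Pi.smul_apply, Algebra.smul_def, Pi.zero_apply] at h
    exact (isUnit_algebraMap_of_mem x hk).mul_right_eq_zero.1 h
  · rw [cechD_apply]
    refine Finset.sum_eq_zero fun s _ => ?_
    rw [hc _ fun h => hk (Finset.mem_of_mem_erase h), map_zero, smul_zero]

/-- By contraposition: each multihomogeneous component of a cocycle of degree `j` is zero or `x_k`
times a cocycle of degree `j - 1`, hence a boundary if all of the latter are. -/
theorem cechCohomologyPiece_sub_one_ne_bot {x : Fin r → R}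
    {ρ : R →ₐ[K] AddMonoidAlgebra R (Fin r → ℤ)}
    (hρ : ∀ i, ρ (x i) = AddMonoidAlgebra.single (Pi.single i 1) (x i))
    (hx : Submodule.span K (Set.range fun u : Fin r → ℕ => ∏ i, x i ^ u i) = ⊤)
    {A : Finset (Fin r)} {𝒜 : ℕ → Submodule K R}
    (h𝒜 : ∀ d, 𝒜 d = Submodule.span K ((fun u : Fin r → ℕ => ∏ i, x i ^ u i) ''
      {u | ∑ i ∈ A, u i = d})) {t : ℕ} {j : ℤ} (hj : j < 0)
    (h : cechCohomologyPiece 𝒜 x A t j ≠ ⊥) : cechCohomologyPiece 𝒜 x A t (j - 1) ≠ ⊥ := by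
  classical
  contrapose! h
  rw [cechCohomologyPiece_eq_bot_iff] at h ⊢
  intro c hc hd
  obtain ⟨T, hT⟩ := exists_sum_cechCochainComponent hρ hx A t c
  rw [← hT]
  refine sum_mem fun a _ => ?_
  have hsub : ∀ F : ↥(A.powersetCard t), F.1 ⊆ A := fun F => (Finset.mem_powersetCard.1 F.2).1
  by_cases ha : ∑ i ∈ A, a i = j
  · obtain ⟨k, hkA, hk⟩ : ∃ k ∈ A, a k < 0 := by
      by_contra! hnonneg
      exact (Finset.sum_nonneg hnonneg).not_gt (ha ▸ hj)
    -- Division by `x_k`, placewise: possible where `x_k` is inverted, and elsewhere the component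
    -- is already zero. The zero choice off `k` is what makes `w` a cocycle.
    have hw : ∀ F : ↥(A.powersetCard t), ∃ w ∈ cechLocPiece 𝒜 x F.1 (j - 1), (k ∉ F.1 → w = 0) ∧
        x k • w = cechCochainComponent hρ A t a c F := by
      intro F
      have hmem := cechComponent_mem hρ hx F.1 a (c F)
      by_cases hkF : k ∈ F.1
      · obtain ⟨w, hw, hkw⟩ := exists_mul_eq_of_mem_cechFinePiece hkF hmem
        refine ⟨w, ?_, fun h => absurd hkF h, hkw⟩
        have := cechFinePiece_le_cechLocPiece h𝒜 (hsub F) _ hw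
        simpa [Finset.sum_sub_distrib, Finset.sum_pi_single', hkA, ha] using this
      · rw [cechFinePiece_eq_bot hkF hk, Submodule.mem_bot] at hmem
        exact ⟨0, zero_mem _, fun _ => rfl, (smul_zero _).trans hmem.symm⟩
    choose w hw hw0 hkw using hw
    have hkw' : x k • (w : CechCochain x A t) = cechCochainComponent hρ A t a c := funext hkw
    rw [← hkw']
    refine Submodule.smul_mem _ _ (h w (fun F _ => hw F) (cechD_eq_zero_of_smul hw0 ?_))
    rw [hkw', cechD_cechCochainComponent, hd]
    exact funext fun G => map_zero (cechComponent hρ G.1 a)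
  · have : cechCochainComponent hρ A t a c = 0 := by
      funext F
      have hF : c F ∈ cechLocPiece 𝒜 x F.1 j := hc F (Set.mem_univ F)
      exact cechComponent_eq_zero_of_mem_cechLocPiece hρ h𝒜 (hsub F) ha hF
    rw [this]
    exact zero_mem _

theorem isTame_cechCohomologyPiece {x : Fin r → R}
    {ρ : R →ₐ[K] AddMonoidAlgebra R (Fin r → ℤ)}
    (hρ : ∀ i, ρ (x i) = AddMonoidAlgebra.single (Pi.single i 1) (x i))
    (hx : Submodule.span K (Set.range fun u : Fin r → ℕ => ∏ i, x i ^ u i) = ⊤)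
    {A : Finset (Fin r)} {𝒜 : ℕ → Submodule K R}
    (h𝒜 : ∀ d, 𝒜 d = Submodule.span K ((fun u : Fin r → ℕ => ∏ i, x i ^ u i) ''
      {u | ∑ i ∈ A, u i = d})) (t : ℕ) : IsTame (cechCohomologyPiece 𝒜 x A t) := by
  by_cases h : ∃ j < 0, cechCohomologyPiece 𝒜 x A t j ≠ ⊥
  · obtain ⟨j₀, hj₀, h⟩ := h
    refine ⟨j₀, Or.inr fun j hj => ?_⟩
    induction j, hj using Int.leInductionDown with
    | base => exact h
    | pred j hj ih =>
      exact cechCohomologyPiece_sub_one_ne_bot hρ hx h𝒜 (hj.trans_lt hj₀) ih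
  · push Not at h
    -- All negative degrees vanish here, so `-1` serves as the bound.
    exact ⟨-1, Or.inl fun j hj => h j (by omega)⟩

end Lowering

/-! ### Quotients by monomial ideals -/

section MonomialQuotient

variable {K : Type*} [Field K] {r : ℕ} {I : Ideal (MvPolynomial (Fin r) K)}

theorem mk_monomial_one (a : Fin r →₀ ℕ) :
    Ideal.Quotient.mk I (monomial a (1 : K)) = ∏ i, residueVar I i ^ a i := by
  rw [monomial_eq, C_1, one_mul, Finsupp.prod_fintype _ _ (fun i => pow_zero _), map_prod]
  simp [residueVar]

/-- A quotient by a monomial ideal carries the coaction of the torus. -/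
theorem IsMonomialIdeal.exists_coaction (hI : IsMonomialIdeal I) :
    ∃ ρ : MvPolynomial (Fin r) K ⧸ I →ₐ[K]
      AddMonoidAlgebra (MvPolynomial (Fin r) K ⧸ I) (Fin r → ℤ),
      ∀ i, ρ (residueVar I i) = AddMonoidAlgebra.single (Pi.single i 1) (residueVar I i) := by
  let φ : MvPolynomial (Fin r) K →ₐ[K] AddMonoidAlgebra (MvPolynomial (Fin r) K ⧸ I) (Fin r → ℤ) :=
    aeval fun i => AddMonoidAlgebra.single (Pi.single i (1 : ℤ)) (residueVar I i)
  have hφ : ∀ f ∈ I, φ f = 0 := by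
    obtain ⟨T, hT⟩ := hI
    -- A generator `Y^a` goes to its own residue class placed in degree `a`, which is zero. For a
    -- non-monomial generator the terms would land in different degrees and need not vanish
    -- separately.
    have hle : I ≤ RingHom.ker φ := by
      conv_lhs => rw [hT]
      rw [Ideal.span_le]
      rintro _ ⟨a, ha, rfl⟩
      have hmem : monomial a (1 : K) ∈ I := by
        rw [hT]; exact Ideal.subset_span ⟨a, ha, rfl⟩
      rw [SetLike.mem_coe, RingHom.mem_ker, aeval_monomial, map_one, one_mul,
        Finsupp.prod_fintype _ _ (fun i => pow_zero _)]
      simp only [AddMonoidAlgebra.single_pow, AddMonoidAlgebra.prod_single]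
      rw [← mk_monomial_one, Ideal.Quotient.eq_zero_iff_mem.2 hmem, AddMonoidAlgebra.single_zero]
    exact fun f hf => hle hf
  refine ⟨Ideal.Quotient.liftₐ I φ hφ, fun i => ?_⟩
  exact aeval_X _ i

theorem image_monomial_eq (s : Set (Fin r →₀ ℕ)) :
    (fun a => Ideal.Quotient.mk I (monomial a (1 : K))) '' s =
      (fun u : Fin r → ℕ => ∏ i, residueVar I i ^ u i) '' ((fun a : Fin r →₀ ℕ => ⇑a) '' s) := by
  rw [Set.image_image]
  exact Set.image_congr fun a _ => mk_monomial_one a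

theorem map_supported_eq_span (s : Set (Fin r →₀ ℕ)) :
    (AddMonoidAlgebra.supported K K s).map (Ideal.Quotient.mkₐ K I).toLinearMap =
      Submodule.span K ((fun u : Fin r → ℕ => ∏ i, residueVar I i ^ u i) ''
        ((fun a : Fin r →₀ ℕ => ⇑a) '' s)) := by
  rw [AddMonoidAlgebra.supported_eq_span_single, Submodule.map_span, Set.image_image,
    ← image_monomial_eq]
  rfl

theorem span_residueVar_eq_top :
    Submodule.span K (Set.range fun u : Fin r → ℕ => ∏ i, residueVar I i ^ u i) = ⊤ := by
  have h := map_supported_eq_span (K := K) (I := I) Set.univ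
  have hsurj : (fun a : Fin r →₀ ℕ => ⇑a) '' Set.univ = Set.univ :=
    Set.image_univ_of_surjective Finsupp.equivFunOnFinite.surjective
  rw [hsurj, Set.image_univ] at h
  have htop : AddMonoidAlgebra.supported K K (Set.univ : Set (Fin r →₀ ℕ)) = ⊤ :=
    eq_top_iff.2 fun f _ => AddMonoidAlgebra.mem_supported.2 (Set.subset_univ _)
  rw [← h, htop, Submodule.map_top, LinearMap.range_eq_top]
  exact Ideal.Quotient.mk_surjective

/-- Weighted homogeneous polynomials are spanned by their monomials, and the `0`-`1` weights turn
the degree of `Y^u` into the sum of `u` over `varsIn P`. -/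
theorem quotientPiece_eq_span (P : Ideal (MvPolynomial (Fin r) K ⧸ I)) (d : ℕ) :
    quotientPiece P d = Submodule.span K ((fun u : Fin r → ℕ => ∏ i, residueVar I i ^ u i) ''
      {u | ∑ i ∈ varsIn P, u i = d}) := by
  rw [quotientPiece, weightedHomogeneousSubmodule_eq_finsupp_supported, map_supported_eq_span]
  congr 2
  ext u
  have hweight : ∀ a : Fin r →₀ ℕ, Finsupp.weight (primeWeight P) a = ∑ i ∈ varsIn P, a i := by
    intro a
    rw [Finsupp.weight_apply, Finsupp.sum_fintype _ _ (by simp)]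
    simp [primeWeight, Finset.sum_ite_mem]
  simp only [hweight, Set.mem_image, Set.mem_ofPred_eq]
  constructor
  · rintro ⟨a, ha, rfl⟩
    exact ha
  · exact fun hu => ⟨Finsupp.equivFunOnFinite.symm u, hu, rfl⟩

end MonomialQuotient

theorem mainTheorem1 {K : Type*} [Field K] {r : ℕ} (I : Ideal (MvPolynomial (Fin r) K))
    (hI : IsMonomialIdeal I) (P : Ideal (MvPolynomial (Fin r) K ⧸ I)) (hP : IsMonomialPrime P)
    (i : ℕ) : IsTame (monomialLocalCohomologyPiece P i) := by
  obtain ⟨ρ, hρ⟩ := hI.exists_coaction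
  exact isTame_cechCohomologyPiece hρ span_residueVar_eq_top (quotientPiece_eq_span P) i
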